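/- Let $m,n\ge 0$ be integers, let $A$ be an $m\times n$ matrix with entries in $\{0,1\}$ ($A_{le}=1$ if the path of user $e$ uses link $l$), each of whose columns contains at least one entry $1$, and let $c\in\mathbb{R}^m$. Let $\mathcal{A}=\{x\in\mathbb{R}^n : x\ge 0,\ Ax\le c\}$ and assume that there is a point $x$ with $x(e)>0$ for all $e$ and $(Ax)(l)<c(l)$ for all $l$. For $e=1,\dots,n$ let $w_e:[0,\infty)\to\mathbb{R}$ be strictly concave, increasing, continuous on $[0,\infty)$ and differentiable on $(0,\infty)$ (no differentiability at $0$ is assumed). Put $p_e(x(e))=x(e)\,w_e'(x(e))$, with $p_e(0)=0$, and for $x\in\mathcal{A}$ let $$T(x)=\arg\max_{y\in\mathcal{A}}\ \sum_{e=1}^n p_e(x(e))\log y(e)\subseteq\mathcal{A},$$ where $\log 0=-\infty$ and $0\cdot(-\infty)=0$. An algorithm starts from a point $x^{(0)}\in\mathcal{A}$ with $x^{(0)}(e)>0$ for all $e$ and, for $k=0,1,2,\dots$, chooses any $v\in T(x^{(k)})$ and sets $$x^{(k+1)}=x^{(k)}+\frac{1}{k+2}\,\bigl(v-x^{(k)}\bigr).$$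 Then $W(x)=\sum_{e=1}^n w_e(x(e))$ has a unique maximizer $x^\star$ over $\mathcal{A}$; from every such start $x^{(0)}$ the algorithm can be run for ever (that is, suitable points $v$ exist); and, whatever the start and the choices of $v$, all the iterates $x^{(k)}$ lie in $\mathcal{A}$ and $x^{(k)}\to x^\star$ as $k\to\infty$. -/

import Mathlib

open scoped Matrix

noncomputable section

namespace NUM

variable {m n : ℕ}

/-- The feasible set `{x | x ≥ 0 and A x ≤ c}` of flow vectors. -/
def feasible (A : Matrix (Fin m) (Fin n) ℝ) (c : Fin m → ℝ) : Set (Fin n → ℝ) :=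
  {x | (∀ e, 0 ≤ x e) ∧ ∀ l, (A *ᵥ x) l ≤ c l}

/-- The total utility `W(x) = ∑ₑ wₑ(x(e))`. -/
def totalUtility (w : Fin n → ℝ → ℝ) (x : Fin n → ℝ) : ℝ :=
  ∑ e, w e (x e)

/-- The set of optimal solutions of the system problem: maximize `W` over the feasible set. -/
def systemSolutions (A : Matrix (Fin m) (Fin n) ℝ) (c : Fin m → ℝ) (w : Fin n → ℝ → ℝ) :
    Set (Fin n → ℝ) :=
  {x | x ∈ feasible A c ∧ IsMaxOn (totalUtility w) (feasible A c) x}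

/-- The objective `∑ₑ pₑ log y(e)` of the network problem, as an extended real number:
`log 0 = -∞`, with the convention `0 * (-∞) = 0`. -/
def networkObjective (p : Fin n → ℝ) (y : Fin n → ℝ) : EReal :=
  ∑ e, (p e : EReal) * ENNReal.log (ENNReal.ofReal (y e))

/-- The set of optimal solutions of the network problem with prices `p`. -/
def networkSolutions (A : Matrix (Fin m) (Fin n) ℝ) (c : Fin m → ℝ) (p : Fin n → ℝ) :
    Set (Fin n → ℝ) :=
  {y | y ∈ feasible A c ∧ IsMaxOn (networkObjective p) (feasible A c) y}

/-- The price vector `pₑ(x(e)) = x(e) wₑ'(x(e))`. -/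
def price (w : Fin n → ℝ → ℝ) (x : Fin n → ℝ) : Fin n → ℝ :=
  fun e => x e * deriv (w e) (x e)

/-- The set-valued map `T(x) = argmax_{y feasible} ∑ₑ pₑ(x(e)) log y(e)`. -/
def T (A : Matrix (Fin m) (Fin n) ℝ) (c : Fin m → ℝ) (w : Fin n → ℝ → ℝ)
    (x : Fin n → ℝ) : Set (Fin n → ℝ) :=
  networkSolutions A c (price w x)

/-- The step sizes `a_k = 1 / (k + 1)`. -/
def stepSize (k : ℕ) : ℝ := 1 / ((k : ℝ) + 1)

/-- `x` is a sequence of iterates of the algorithm: the start is feasible and strictly positive,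
and `x (k+1) = x k + a_{k+1} (v - x k)` for some (arbitrarily chosen) `v ∈ T (x k)`. -/
structure IsRun (A : Matrix (Fin m) (Fin n) ℝ) (c : Fin m → ℝ) (w : Fin n → ℝ → ℝ)
    (x : ℕ → Fin n → ℝ) : Prop where
  start_feasible : x 0 ∈ feasible A c
  start_pos : ∀ e, 0 < x 0 e
  step : ∀ k, ∃ v ∈ T A c w (x k), x (k + 1) = x k + stepSize (k + 1) • (v - x k)

end NUM

end

/-!
The iterates stay in the open positive orthant, but the map `T` can have fixed points on the
boundary that are not optimal, so the total utility `W` is not a suitable Lyapunov function.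
Instead, let `xs` be the maximizer of `W` and consider `Φ x = ∑ₑ xs(e) ∫ wₑ'(s) / s ds`, the
integral running from `xs(e)` to `x(e)`. If `v ∈ T x`, the first-order condition of the network
problem, tested against `xs`, says that `∑ₑ wₑ'(x(e)) xs(e) x(e) / v(e) ≤ ∑ₑ wₑ'(x(e)) x(e)`.
Since `r - 1 ≥ 1 - 1 / r` for `r = v(e) / x(e)`, the derivative of `Φ` in direction `v - x` is at
least `∑ₑ wₑ'(x(e)) (xs(e) - x(e))`, hence at least the gap `W xs - W x` by concavity. Moreover
`Φ` attains its maximum over the feasible set only at `xs`.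

The derivative `wₑ'` may be unbounded and wildly varying near `0`, so the discretization error of
`Φ` is not under control there. Therefore `wₑ'(s)` is replaced by `wₑ'(max δ s)` (`marginal`,
`potential`, `lyapunov`). The argument survives because the network problem may be tested against
any feasible point, and every point between `0` and `xs` is feasible: the new weights amount to
the test point `xs(e) wₑ'(max δ x(e)) / wₑ'(x(e))`. The truncation costs at most
`∑ₑ (wₑ(δ) - wₑ(0))`, which is small with `δ`. In the variable `log x` the truncated weights are
uniformly continuous, so a step of size `a` changes the Lyapunov function by at least `a` times
the gap minus small errors (`lyapunov_step`).

As the step sizes are not summable, the gap is small infinitely often, and the Lyapunov function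
increases whenever it is not small; so the Lyapunov function is eventually close to its maximum
`0` (`eventually_gt_of_step`). Its deficit dominates `∑ₑ qₑ (√x(e) - √xs(e))²` with positive `qₑ`
(`lyapunov_le`), which gives convergence in every coordinate, including those with `xs(e) = 0`.
-/

namespace NUM

open Set Filter Topology

/-! ### Utility functions of one variable -/

/-- The properties required of a utility function on `[0, ∞)`. Nothing is required of the junk
values on negative arguments, nor of the derivative at `0`. -/
structure IsUtility (w : ℝ → ℝ) : Prop where
  strictConcaveOn : StrictConcaveOn ℝ (Ici 0) w
  monotoneOn : MonotoneOn w (Ici 0)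
  continuousOn : ContinuousOn w (Ici 0)
  differentiableAt : ∀ t : ℝ, 0 < t → DifferentiableAt ℝ w t

namespace IsUtility

variable {w : ℝ → ℝ}

theorem strictMonoOn (hw : IsUtility w) : StrictMonoOn w (Ici 0) := by
  intro x hx y hy hxy
  refine lt_of_le_of_ne (hw.monotoneOn hx hy hxy.le) fun heq => ?_
  have h := hw.strictConcaveOn.2 hx hy hxy.ne (half_pos one_pos) (half_pos one_pos)
    (by norm_num : (1 / 2 : ℝ) + 1 / 2 = 1)
  simp only [smul_eq_mul] at h
  have hx' : (0 : ℝ) ≤ x := hx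
  have h2 := hw.monotoneOn (a := 1 / 2 * x + 1 / 2 * y) (b := y)
    (by simp only [mem_Ici]; linarith) hy (by linarith)
  linarith

theorem strictAntiOn_deriv (hw : IsUtility w) : StrictAntiOn (deriv w) (Ioi 0) :=
  (hw.strictConcaveOn.subset Ioi_subset_Ici_self (convex_Ioi 0)).strictAntiOn_deriv
    hw.differentiableAt

theorem deriv_le_deriv (hw : IsUtility w) {x y : ℝ} (hx : 0 < x) (hxy : x ≤ y) :
    deriv w y ≤ deriv w x :=
  hw.strictAntiOn_deriv.antitoneOn hx (hx.trans_le hxy) hxy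

/-- The graph of a concave function lies below its tangents. -/
theorem le_tangent (hw : IsUtility w) {x y : ℝ} (hx : 0 < x) (hy : 0 ≤ y) :
    w y ≤ w x + deriv w x * (y - x) := by
  rcases lt_trichotomy x y with h | rfl | h
  · have := hw.strictConcaveOn.concaveOn.slope_le_deriv hx.le hy h (hw.differentiableAt x hx)
    rw [slope_def_field, div_le_iff₀ (by linarith)] at this
    linarith
  · simp
  · have := hw.strictConcaveOn.concaveOn.deriv_le_slope hy hx.le h (hw.differentiableAt x hx)
    rw [slope_def_field, le_div_iff₀ (by linarith)] at this
    linarith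

theorem deriv_pos (hw : IsUtility w) {x : ℝ} (hx : 0 < x) : 0 < deriv w x := by
  have h1 := hw.le_tangent hx (by linarith : (0 : ℝ) ≤ x + 1)
  have h2 := hw.strictMonoOn hx.le (by simp only [mem_Ici]; linarith : x + 1 ∈ Ici (0 : ℝ))
    (by linarith)
  linarith

/-- The derivative of a differentiable concave function is continuous: it is monotone, and by
Darboux's theorem it has no jumps. -/
theorem continuousOn_deriv (hw : IsUtility w) : ContinuousOn (deriv w) (Ioi 0) := by
  intro a ha
  have ha' : 0 < a := ha
  have hD : OrdConnected (deriv w '' Ioi 0) := ordConnected_Ioi.image_deriv hw.differentiableAt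
  have hmono : StrictMonoOn (fun x => -deriv w x) (Ioi 0) := hw.strictAntiOn_deriv.neg
  have hcont : ContinuousAt (fun x => -deriv w x) a := by
    refine hmono.continuousAt_of_exists_between (Ioi_mem_nhds ha) (fun b hb => ?_) fun b hb => ?_
    · have hlt := hmono (a := a / 2) (half_pos ha') ha (half_lt_self ha')
      rcases le_or_gt b (-deriv w (a / 2)) with h | h
      · exact ⟨a / 2, half_pos ha', h, hlt⟩
      · obtain ⟨c, hc, hcb⟩ := hD.out (mem_image_of_mem _ ha)
          (mem_image_of_mem _ (half_pos ha' : a / 2 ∈ Ioi 0))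
          (show -b ∈ Icc _ _ from ⟨by linarith, by linarith⟩)
        exact ⟨c, hc, by simp only [hcb, mem_Ico]; constructor <;> linarith⟩
    · have hlt := hmono (b := a + 1) ha (by simp only [mem_Ioi]; linarith) (by linarith)
      rcases le_or_gt (-deriv w (a + 1)) b with h | h
      · exact ⟨a + 1, by simp only [mem_Ioi]; linarith, hlt, h⟩
      · obtain ⟨c, hc, hcb⟩ := hD.out
          (mem_image_of_mem _ (by simp only [mem_Ioi]; linarith : a + 1 ∈ Ioi (0 : ℝ)))
          (mem_image_of_mem _ ha)
          (show -b ∈ Icc _ _ from ⟨by linarith, by linarith⟩)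
        exact ⟨c, hc, by simp only [hcb, mem_Ioc]; constructor <;> linarith⟩
  exact (by simpa using hcont.fun_neg : ContinuousAt (deriv w) a).continuousWithinAt

end IsUtility

/-! ### The truncated marginal utility -/

/-- The marginal utility `w'` in the logarithmic variable `t = log x`, with the argument `x`
clamped to `[δ, M]`. Unlike `w'` itself, which may blow up at `0`, it is bounded and uniformly
continuous on the whole line. -/
noncomputable def marginal (w : ℝ → ℝ) (δ M t : ℝ) : ℝ :=
  deriv w (Real.exp (max (Real.log δ) (min (Real.log M) t)))

/-- The primitive of the truncated marginal utility that vanishes at `b`. As a function of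
`x = exp t` its derivative is `w' (max δ x) / x` for `0 < x < M`. -/
noncomputable def potential (w : ℝ → ℝ) (δ M b t : ℝ) : ℝ :=
  ∫ s in b..t, marginal w δ M s

theorem marginal_log {w : ℝ → ℝ} {δ M : ℝ} (hδ : 0 < δ) {x : ℝ} (hx : 0 < x) (hxM : x ≤ M) :
    marginal w δ M (Real.log x) = deriv w (max δ x) := by
  have hl : Real.log x ≤ Real.log M := Real.log_le_log hx hxM
  rw [marginal, min_eq_right hl]
  congr 1
  rcases le_total δ x with h | h
  · rw [max_eq_right h, max_eq_right (Real.log_le_log hδ h), Real.exp_log hx]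
  · rw [max_eq_left h, max_eq_left (Real.log_le_log hx h), Real.exp_log hδ]

theorem potential_self (w : ℝ → ℝ) (δ M b : ℝ) : potential w δ M b b = 0 := by simp [potential]

namespace IsUtility

variable {w : ℝ → ℝ} {δ M : ℝ}

theorem marginal_pos (hw : IsUtility w) (t : ℝ) : 0 < marginal w δ M t :=
  hw.deriv_pos (Real.exp_pos _)

theorem marginal_antitone (hw : IsUtility w) : Antitone (marginal w δ M) := by
  intro s t hst
  refine hw.deriv_le_deriv (Real.exp_pos _) (Real.exp_le_exp.2 ?_)
  gcongr

theorem continuous_marginal (hw : IsUtility w) : Continuous (marginal w δ M) := by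
  refine hw.continuousOn_deriv.comp_continuous ?_ fun t => Real.exp_pos _
  fun_prop

theorem uniformContinuous_marginal (hw : IsUtility w) (hδ : 0 < δ) (hM : δ ≤ M) :
    UniformContinuous (marginal w δ M) := by
  have hl : Real.log δ ≤ Real.log M := Real.log_le_log hδ hM
  have h : marginal w δ M = (fun s : Icc (Real.log δ) (Real.log M) => deriv w (Real.exp s)) ∘
      projIcc _ _ hl := rfl
  rw [h]
  refine UniformContinuous.comp (CompactSpace.uniformContinuous_of_continuous ?_)
    (LipschitzWith.projIcc hl).uniformContinuous
  exact hw.continuousOn_deriv.comp_continuous (by fun_prop) fun t => Real.exp_pos _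

theorem potential_sub (hw : IsUtility w) (b s t : ℝ) :
    potential w δ M b t - potential w δ M b s = ∫ u in s..t, marginal w δ M u :=
  intervalIntegral.integral_interval_sub_left (hw.continuous_marginal.intervalIntegrable _ _)
    (hw.continuous_marginal.intervalIntegrable _ _)

theorem potential_monotone (hw : IsUtility w) (b : ℝ) : Monotone (potential w δ M b) := by
  intro s t hst
  rw [← sub_nonneg, hw.potential_sub]
  exact intervalIntegral.integral_nonneg hst fun u _ => (hw.marginal_pos u).le

theorem potential_sub_le (hw : IsUtility w) (b s t : ℝ) :
    potential w δ M b t - potential w δ M b s ≤ (t - s) * marginal w δ M s := by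
  rw [hw.potential_sub]
  have hi := hw.continuous_marginal (δ := δ) (M := M)
  rcases le_total s t with h | h
  · have := intervalIntegral.integral_mono_on h (hi.intervalIntegrable _ _)
      (intervalIntegrable_const (μ := MeasureTheory.volume) (c := marginal w δ M s))
      fun u hu => hw.marginal_antitone hu.1
    simpa using this
  · have := intervalIntegral.integral_mono_on h
      (intervalIntegrable_const (μ := MeasureTheory.volume) (c := marginal w δ M s))
      (hi.intervalIntegrable _ _) fun u hu => hw.marginal_antitone hu.2
    rw [intervalIntegral.integral_symm]
    simp only [intervalIntegral.integral_const, smul_eq_mul] at this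
    linarith

theorem le_potential_sub (hw : IsUtility w) (b s t : ℝ) :
    (t - s) * marginal w δ M t ≤ potential w δ M b t - potential w δ M b s := by
  have := hw.potential_sub_le (δ := δ) (M := M) b t s
  linarith

/-- One step in a single coordinate, where `t = log x` and `r = v / x`: up to an error that is
uniformly `o(a)`, the potential grows by at least `a * (1 - 1 / r)` times the marginal utility.
The quantity `1 - 1 / r`, not `r - 1`, is what optimality of `v` in the network problem controls.
-/
theorem potential_step (hw : IsUtility w) {a r : ℝ} (ha : 0 < a) (ha' : a ≤ 1 / 2) (hr : 0 < r)
    (b t : ℝ) :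
    a * (1 - 1 / r) * marginal w δ M t
        - 2 * a * (marginal w δ M (t - 2 * a) - marginal w δ M (t + a))
      ≤ potential w δ M b (t + Real.log (1 + a * (r - 1))) - potential w δ M b t := by
  have hpos : 0 < 1 + a * (r - 1) := by nlinarith
  -- concavity of the logarithm along `(1 - a) * 1 + a * r`
  have hlog : a * (1 - 1 / r) ≤ Real.log (1 + a * (r - 1)) := by
    have h1 : a * Real.log r ≤ Real.log (1 + a * (r - 1)) := by
      have := strictConcaveOn_log_Ioi.concaveOn.2 (mem_Ioi.2 one_pos) (mem_Ioi.2 hr)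
        (by linarith : 0 ≤ 1 - a) ha.le (by ring)
      simp only [smul_eq_mul, Real.log_one, mul_zero, zero_add] at this
      refine this.trans_eq ?_
      ring_nf
    have h2 : 1 - 1 / r ≤ Real.log r := by
      rw [one_div]; exact Real.one_sub_inv_le_log_of_pos hr
    nlinarith
  set d := Real.log (1 + a * (r - 1)) with hd
  have hanti := hw.marginal_antitone (δ := δ) (M := M)
  have hU1 := hanti (by linarith : t - 2 * a ≤ t)
  have hU2 := hanti (by linarith : t ≤ t + a)
  rcases le_total 1 r with h | h
  · -- the increment of `t` may be large; only the part `a * (1 - 1 / r) ≤ a` of it is used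
    have h0 : 0 ≤ 1 - 1 / r := by
      rw [sub_nonneg, div_le_one hr]; exact h
    have h0' : 1 - 1 / r ≤ 1 := by
      have : 0 < 1 / r := by positivity
      linarith
    have h1 := hw.potential_monotone (δ := δ) (M := M) b
      (by linarith : t + a * (1 - 1 / r) ≤ t + d)
    have h2 := hw.le_potential_sub (δ := δ) (M := M) b t (t + a * (1 - 1 / r))
    have h3 := hanti (by nlinarith : t + a * (1 - 1 / r) ≤ t + a)
    have h4 : 0 ≤ a * (1 - 1 / r) := mul_nonneg ha.le h0
    have h5 : a * (1 - 1 / r) ≤ a := by nlinarith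
    have h6 : a * (1 - 1 / r) * (marginal w δ M t - marginal w δ M (t + a)) ≤
        a * (marginal w δ M t - marginal w δ M (t + a)) :=
      mul_le_mul_of_nonneg_right h5 (by linarith)
    nlinarith
  · have hd0 : d ≤ 0 := Real.log_nonpos hpos.le (by nlinarith)
    have hd1 : -(2 * a) ≤ d := by
      have h1 := Real.one_sub_inv_le_log_of_pos hpos
      have h2 : (1 + a * (r - 1))⁻¹ ≤ 1 + 2 * a := by
        rw [inv_le_comm₀ hpos (by linarith), inv_eq_one_div, div_le_iff₀ (by linarith)]
        nlinarith [mul_pos ha hr, mul_pos ha (mul_pos ha hr)]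
      linarith
    have h2 := hw.le_potential_sub (δ := δ) (M := M) b t (t + d)
    have h3 := hanti (by linarith : t - 2 * a ≤ t + d)
    have h3' := hanti (by linarith : t + d ≤ t)
    have h4 : a * (1 - 1 / r) * marginal w δ M t ≤ d * marginal w δ M t :=
      mul_le_mul_of_nonneg_right hlog (hw.marginal_pos t).le
    have h5 : -(2 * a) * (marginal w δ M (t + d) - marginal w δ M t) ≤
        d * (marginal w δ M (t + d) - marginal w δ M t) :=
      mul_le_mul_of_nonneg_right hd1 (by linarith)
    nlinarith

end IsUtility

/-! ### The feasible set -/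

section Feasible

variable {m n : ℕ} {A : Matrix (Fin m) (Fin n) ℝ} {c : Fin m → ℝ}

theorem convex_feasible : Convex ℝ (feasible A c) := by
  intro x hx y hy a b ha hb hab
  refine ⟨fun e => ?_, fun l => ?_⟩
  · have h1 := mul_nonneg ha (hx.1 e)
    have h2 := mul_nonneg hb (hy.1 e)
    simpa using add_nonneg h1 h2
  · rw [Matrix.mulVec_add, Matrix.mulVec_smul, Matrix.mulVec_smul]
    have h1 := mul_le_mul_of_nonneg_left (hx.2 l) ha
    have h2 := mul_le_mul_of_nonneg_left (hy.2 l) hb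
    simp only [Pi.add_apply, Pi.smul_apply, smul_eq_mul]
    calc _ ≤ a * c l + b * c l := add_le_add h1 h2
      _ = c l := by rw [← add_mul, hab, one_mul]

theorem isClosed_feasible : IsClosed (feasible A c) := by
  have : feasible A c = (⋂ e, {x | 0 ≤ x e}) ∩ ⋂ l, {x | (A *ᵥ x) l ≤ c l} := by
    ext x; simp [feasible]
  rw [this]
  refine (isClosed_iInter fun e => isClosed_le continuous_const (continuous_apply e)).inter
    (isClosed_iInter fun l => isClosed_le ?_ continuous_const)
  exact (continuous_apply l).comp (continuous_const.matrix_mulVec continuous_id)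

theorem mem_feasible_of_le (hA : ∀ l e, A l e = 0 ∨ A l e = 1) {x y : Fin n → ℝ}
    (hx : x ∈ feasible A c) (hy : ∀ e, 0 ≤ y e) (hyx : ∀ e, y e ≤ x e) : y ∈ feasible A c := by
  refine ⟨hy, fun l => le_trans ?_ (hx.2 l)⟩
  simp only [Matrix.mulVec, dotProduct]
  refine Finset.sum_le_sum fun e _ => ?_
  rcases hA l e with h | h <;> simp [h, hyx e]

theorem exists_bound (hA : ∀ l e, A l e = 0 ∨ A l e = 1) (hpath : ∀ e, ∃ l, A l e = 1) :
    ∃ M, 0 < M ∧ ∀ x ∈ feasible A c, ∀ e, x e ≤ M := by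
  refine ⟨1 + ∑ l, |c l|, by positivity, fun x hx e => ?_⟩
  obtain ⟨l, hl⟩ := hpath e
  have h1 : x e ≤ (A *ᵥ x) l := by
    have := Finset.single_le_sum (f := fun e => A l e * x e) (fun e _ => ?_) (Finset.mem_univ e)
    · simpa [hl, Matrix.mulVec, dotProduct] using this
    · rcases hA l e with h | h <;> simp [h, hx.1 e]
  have h2 := Finset.single_le_sum (f := fun l => |c l|) (fun l _ => abs_nonneg _)
    (Finset.mem_univ l)
  have h3 := hx.2 l
  have h4 := le_abs_self (c l)
  linarith

theorem isCompact_feasible (hA : ∀ l e, A l e = 0 ∨ A l e = 1) (hpath : ∀ e, ∃ l, A l e = 1) :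
    IsCompact (feasible A c) := by
  obtain ⟨M, -, hM⟩ := exists_bound (c := c) hA hpath
  refine (isCompact_Icc (a := (0 : Fin n → ℝ)) (b := fun _ => M)).of_isClosed_subset
    isClosed_feasible fun x hx => ⟨hx.1, hM x hx⟩

end Feasible

/-! ### The network problem -/

/-- A function on `[0, 1)` that is largest at `0` has a nonpositive derivative there. -/
theorem deriv_nonpos_of_right_max {g : ℝ → ℝ} {g' : ℝ} (hg : HasDerivAt g g' 0)
    (hmax : ∀ t, 0 < t → t < 1 → g t ≤ g 0) : g' ≤ 0 := by
  refine le_of_tendsto hg.tendsto_slope_zero_right ?_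
  filter_upwards [Ioo_mem_nhdsGT one_pos] with t ht
  have := hmax t ht.1 ht.2
  simp only [zero_add, smul_eq_mul]
  exact mul_nonpos_of_nonneg_of_nonpos (inv_nonneg.2 ht.1.le) (by linarith)

section Network

variable {m n : ℕ} {A : Matrix (Fin m) (Fin n) ℝ} {c : Fin m → ℝ} {p : Fin n → ℝ}

theorem networkObjective_of_pos {y : Fin n → ℝ} (hy : ∀ e, 0 < y e) :
    networkObjective p y = ((∑ e, p e * Real.log (y e) : ℝ) : EReal) := by
  let coeHom : ℝ →+ EReal :=
    { toFun := Real.toEReal, map_zero' := EReal.coe_zero, map_add' := EReal.coe_add }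
  change _ = coeHom _
  rw [networkObjective, map_sum]
  refine Finset.sum_congr rfl fun e _ => ?_
  rw [ENNReal.log_ofReal_of_pos (hy e)]
  exact (EReal.coe_mul _ _).symm

theorem networkObjective_eq_bot (hp : ∀ e, 0 < p e) {y : Fin n → ℝ} {e : Fin n} (hy : y e ≤ 0) :
    networkObjective p y = ⊥ := by
  rw [networkObjective, ← Finset.add_sum_erase _ _ (Finset.mem_univ e), ENNReal.ofReal_of_nonpos hy,
    ENNReal.log_zero, EReal.coe_mul_bot_of_pos (hp e), EReal.bot_add]

theorem pos_of_mem_networkSolutions (hp : ∀ e, 0 < p e)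
    (hint : ∃ x ∈ feasible A c, ∀ e, 0 < x e) {v : Fin n → ℝ}
    (hv : v ∈ networkSolutions A c p) (e : Fin n) : 0 < v e := by
  obtain ⟨x, hx, hx0⟩ := hint
  by_contra! h
  have := hv.2 hx
  rw [mem_ofPred_eq, networkObjective_eq_bot hp h, networkObjective_of_pos hx0, le_bot_iff] at this
  exact EReal.coe_ne_bot _ this

/-- The first-order optimality condition of the network problem. -/
theorem sum_div_le_of_mem_networkSolutions (hp : ∀ e, 0 < p e)
    (hint : ∃ x ∈ feasible A c, ∀ e, 0 < x e) {v y : Fin n → ℝ}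
    (hv : v ∈ networkSolutions A c p) (hy : y ∈ feasible A c) :
    ∑ e, p e * (y e / v e) ≤ ∑ e, p e := by
  have hv0 := pos_of_mem_networkSolutions hp hint hv
  have hderiv : HasDerivAt (fun t : ℝ => ∑ e, p e * Real.log (v e + t * (y e - v e)))
      (∑ e, p e * ((y e - v e) / v e)) 0 := by
    refine HasDerivAt.fun_sum fun e _ => ?_
    have h1 : HasDerivAt (fun t : ℝ => v e + t * (y e - v e)) (y e - v e) 0 := by
      simpa using ((hasDerivAt_id (0 : ℝ)).mul_const (y e - v e)).const_add (v e)
    have h2 := h1.log (by simpa using (hv0 e).ne')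
    simpa using h2.const_mul (p e)
  have hle := deriv_nonpos_of_right_max hderiv fun t ht0 ht1 => by
    have hpos : ∀ e, 0 < v e + t * (y e - v e) := fun e => by
      nlinarith [hv0 e, hy.1 e, mul_pos (sub_pos.2 ht1) (hv0 e), mul_nonneg ht0.le (hy.1 e)]
    have hmem : (fun e => v e + t * (y e - v e)) ∈ feasible A c := by
      convert convex_feasible hv.1 hy (sub_nonneg.2 ht1.le) ht0.le (by ring) using 1
      ext e
      simp only [Pi.add_apply, Pi.smul_apply, smul_eq_mul]
      ring
    have := hv.2 hmem
    rw [mem_ofPred_eq, networkObjective_of_pos hpos, networkObjective_of_pos hv0,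
      EReal.coe_le_coe_iff] at this
    simpa using this
  have heq : ∑ e, p e * ((y e - v e) / v e) = ∑ e, p e * (y e / v e) - ∑ e, p e := by
    rw [← Finset.sum_sub_distrib]
    refine Finset.sum_congr rfl fun e _ => ?_
    have := (hv0 e).ne'
    field_simp
  linarith

/-- With positive prices the network problem has a solution: the product `∏ₑ y(e) ^ pₑ`, whose
logarithm is the objective, is continuous on the compact feasible set. -/
theorem networkSolutions_nonempty (hcomp : IsCompact (feasible A c)) (hp : ∀ e, 0 < p e)
    (hint : ∃ x ∈ feasible A c, ∀ e, 0 < x e) : (networkSolutions A c p).Nonempty := by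
  obtain ⟨x, hx, hx0⟩ := hint
  have hcont : Continuous fun y : Fin n → ℝ => ∏ e, y e ^ p e :=
    continuous_finsetProd _ fun e _ => (continuous_apply e).rpow_const fun _ => Or.inr (hp e).le
  obtain ⟨v, hv, hmax⟩ := hcomp.exists_isMaxOn ⟨x, hx⟩ hcont.continuousOn
  have hprod : ∀ y : Fin n → ℝ, (∀ e, 0 < y e) → 0 < ∏ e, y e ^ p e := fun y hy =>
    Finset.prod_pos fun e _ => Real.rpow_pos_of_pos (hy e) _
  have hlog : ∀ y : Fin n → ℝ, (∀ e, 0 < y e) →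
      Real.log (∏ e, y e ^ p e) = ∑ e, p e * Real.log (y e) := fun y hy => by
    rw [Real.log_prod fun e _ => (Real.rpow_pos_of_pos (hy e) _).ne']
    exact Finset.sum_congr rfl fun e _ => Real.log_rpow (hy e) _
  have hv0 : ∀ e, 0 < v e := fun e => by
    refine (hv.1 e).lt_of_ne fun h => ?_
    have h1 : 0 < ∏ e, v e ^ p e := (hprod x hx0).trans_le (hmax hx)
    rw [Finset.prod_eq_zero (Finset.mem_univ e)] at h1
    · exact h1.false
    · rw [← h, Real.zero_rpow (hp e).ne']
  refine ⟨v, hv, fun y hy => ?_⟩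
  rw [mem_ofPred_eq, networkObjective_of_pos hv0]
  by_cases hy0 : ∀ e, 0 < y e
  · rw [networkObjective_of_pos hy0, EReal.coe_le_coe_iff, ← hlog y hy0, ← hlog v hv0]
    exact Real.log_le_log (hprod y hy0) (hmax hy)
  · push Not at hy0
    obtain ⟨e, he⟩ := hy0
    rw [networkObjective_eq_bot hp he]
    exact bot_le

end Network

/-! ### A recursive inequality with non-summable steps -/

/-- Suppose that `f`, bounded above, changes in step `k` by at least `a k * (g k - η / 2)`, with
step sizes tending to zero but not summable, and that `f` is close to its target whenever `g` is
below `η`. Then `g` falls below `η` at some time, since otherwise `f` would grow without bound;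
from then on `f` either increases or is within a small step of a good value, so it stays good. -/
theorem eventually_gt_of_step {f g a : ℕ → ℝ} {C η β : ℝ} (hη : 0 < η) (hβ : 0 < β)
    (hf : ∀ k, f k ≤ C) (ha : ∀ k, 0 ≤ a k) (ha0 : Tendsto a atTop (𝓝 0)) (hasum : ¬ Summable a)
    (hg : ∀ k, 0 ≤ g k) (hstep : ∀ᶠ k in atTop, f k + a k * (g k - η / 2) ≤ f (k + 1))
    (hsmall : ∀ k, g k < η → -(β / 2) < f k) : ∀ᶠ k in atTop, -β < f k := by
  have hsm : ∀ᶠ k in atTop, a k < β / η := ha0.eventually_lt_const (div_pos hβ hη)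
  obtain ⟨K, hK⟩ := eventually_atTop.1 (hstep.and hsm)
  obtain ⟨K', hKK', hK'⟩ : ∃ k ≥ K, g k < η := by
    by_contra! hcon
    have hlow : ∀ j, f K + (∑ i ∈ Finset.range j, a (i + K)) * (η / 2) ≤ f (j + K) := by
      intro j
      induction j with
      | zero => simp
      | succ j ih =>
        have h1 := (hK (j + K) (by omega)).1
        have h2 := hcon (j + K) (by omega)
        have h3 : a (j + K) * (η / 2) ≤ a (j + K) * (g (j + K) - η / 2) :=
          mul_le_mul_of_nonneg_left (by linarith) (ha _)
        rw [Finset.sum_range_succ, add_mul, show j + 1 + K = j + K + 1 by omega]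
        linarith
    refine hasum ((summable_nat_add_iff K).1
      (summable_of_sum_range_le (c := (C - f K) / (η / 2)) (fun _ => ha _) fun j => ?_))
    rw [le_div_iff₀ (by linarith)]
    have := hlow j
    have := hf (j + K)
    linarith
  refine eventually_atTop.2 ⟨K', fun k hk => ?_⟩
  induction k, hk using Nat.le_induction with
  | base => have := hsmall K' hK'; linarith
  | succ k hk ih =>
    obtain ⟨h1, h2⟩ := hK k (hKK'.trans hk)
    rcases lt_or_ge (g k) η with h | h
    · have h3 := hsmall k h
      rw [lt_div_iff₀ hη] at h2
      have h4 := mul_nonneg (ha k) (hg k)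
      nlinarith
    · have := mul_nonneg (ha k) (by linarith : 0 ≤ g k - η / 2)
      linarith

/-! ### The Lyapunov function along one step -/

namespace IsUtility

variable {w : ℝ → ℝ} {δ M : ℝ}

/-- The truncation at `δ` costs only `w δ - w 0` in the gradient inequality
`w y - w x ≤ deriv w x * (y - x)`. This uses `x * deriv w x ≤ w x - w 0` below `δ`, and is where
continuity of `w` at `0` enters. -/
theorem le_marginal_mul_sub (hw : IsUtility w) (hδ : 0 < δ) {x y : ℝ} (hx : 0 < x) (hxM : x ≤ M)
    (hy : 0 ≤ y) :
    w y - w x - (w δ - w 0) ≤ marginal w δ M (Real.log x) * y - x * deriv w x := by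
  rw [marginal_log hδ hx hxM]
  rcases le_total δ x with h | h
  · rw [max_eq_right h]
    have h1 := hw.le_tangent hx hy
    have h2 := hw.monotoneOn (mem_Ici.2 le_rfl) (mem_Ici.2 hδ.le) hδ.le
    linarith
  · rw [max_eq_left h]
    have h1 := hw.le_tangent hδ hy
    have h2 := hw.le_tangent hx le_rfl
    have h3 := mul_pos hδ (hw.deriv_pos hδ)
    linarith

theorem marginal_log_le (hw : IsUtility w) (hδ : 0 < δ) {x : ℝ} (hx : 0 < x) (hxM : x ≤ M) :
    marginal w δ M (Real.log x) ≤ deriv w x := by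
  rw [marginal_log hδ hx hxM]
  exact hw.deriv_le_deriv hx (le_max_right _ _)

theorem eventually_marginal_sub_lt (hw : IsUtility w) (hδ : 0 < δ) (hM : δ ≤ M) {ε : ℝ}
    (hε : 0 < ε) :
    ∀ᶠ a in 𝓝 (0 : ℝ), ∀ t, marginal w δ M (t - 2 * a) - marginal w δ M (t + a) < ε := by
  obtain ⟨ρ, hρ, h⟩ := Metric.uniformContinuous_iff.1 (hw.uniformContinuous_marginal hδ hM) ε hε
  filter_upwards [Metric.ball_mem_nhds (0 : ℝ) (show 0 < ρ / 3 by positivity)] with a ha t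
  rw [mem_ball_zero_iff, Real.norm_eq_abs] at ha
  refine (le_abs_self _).trans_lt (h ?_)
  rw [Real.dist_eq, show t - 2 * a - (t + a) = -(3 * a) by ring, abs_neg, abs_mul,
    abs_of_pos (by norm_num : (0 : ℝ) < 3)]
  linarith

end IsUtility

section Lyapunov

variable {m n : ℕ} {A : Matrix (Fin m) (Fin n) ℝ} {c : Fin m → ℝ} {w : Fin n → ℝ → ℝ} {δ M : ℝ}
  {xs x : Fin n → ℝ}

/-- The Lyapunov function `∑ₑ xs(e) ψₑ(log x(e))`, where `ψₑ` is the `potential` of `wₑ` with base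
point `log xs(e)`. It is used at positive `x` only. Coordinates with `xs(e) = 0` do not
contribute, so the junk value `log 0` is harmless. -/
noncomputable def lyapunov (w : Fin n → ℝ → ℝ) (δ M : ℝ) (xs x : Fin n → ℝ) : ℝ :=
  ∑ e, xs e * potential (w e) δ M (Real.log (xs e)) (Real.log (x e))

theorem price_pos (hw : ∀ e, IsUtility (w e)) (hx0 : ∀ e, 0 < x e) (e : Fin n) :
    0 < price w x e :=
  mul_pos (hx0 e) ((hw e).deriv_pos (hx0 e))

/-- The increase of the Lyapunov function in one step dominates the step size times the utility
gap, up to a truncation error that is small with `δ` and a discretization error that is small with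
`a`. -/
theorem lyapunov_step (hw : ∀ e, IsUtility (w e)) (hA : ∀ l e, A l e = 0 ∨ A l e = 1)
    (hM : ∀ x ∈ feasible A c, ∀ e, x e ≤ M) (hδ : 0 < δ) (hxs : xs ∈ feasible A c)
    (hx : x ∈ feasible A c) (hx0 : ∀ e, 0 < x e) {v : Fin n → ℝ} (hv : v ∈ T A c w x)
    {a : ℝ} (ha : 0 < a) (ha' : a ≤ 1 / 2) :
    lyapunov w δ M xs x + a * (totalUtility w xs - totalUtility w x - ∑ e, (w e δ - w e 0)
        - 2 * ∑ e, xs e * (marginal (w e) δ M (Real.log (x e) - 2 * a)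
          - marginal (w e) δ M (Real.log (x e) + a)))
      ≤ lyapunov w δ M xs (x + a • (v - x)) := by
  have hp := price_pos hw hx0
  have hv0 := pos_of_mem_networkSolutions hp ⟨x, hx, hx0⟩ hv
  set U : Fin n → ℝ := fun e => marginal (w e) δ M (Real.log (x e)) with hU
  have hU0 : ∀ e, 0 < U e := fun e => (hw e).marginal_pos _
  have hd0 : ∀ e, 0 < deriv (w e) (x e) := fun e => (hw e).deriv_pos (hx0 e)
  -- the competitor that converts the weights `deriv (w e) (x e)` into `U e`
  have hy : (fun e => xs e * (U e / deriv (w e) (x e))) ∈ feasible A c := by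
    refine mem_feasible_of_le hA hxs
      (fun e => mul_nonneg (hxs.1 e) (div_pos (hU0 e) (hd0 e)).le) fun e => ?_
    exact mul_le_of_le_one_right (hxs.1 e)
      ((div_le_one (hd0 e)).2 ((hw e).marginal_log_le hδ (hx0 e) (hM x hx e)))
  have hfo := sum_div_le_of_mem_networkSolutions hp ⟨x, hx, hx0⟩ hv hy
  have hfo' : ∑ e, xs e * U e * (x e / v e) ≤ ∑ e, x e * deriv (w e) (x e) := by
    refine le_trans (le_of_eq (Finset.sum_congr rfl fun e _ => ?_)) hfo
    have h1 := (hd0 e).ne'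
    have h2 := (hv0 e).ne'
    simp only [price]
    field_simp
  have hgap : totalUtility w xs - totalUtility w x - ∑ e, (w e δ - w e 0) ≤
      ∑ e, U e * xs e - ∑ e, x e * deriv (w e) (x e) := by
    simp only [totalUtility, ← Finset.sum_sub_distrib]
    exact Finset.sum_le_sum fun e _ =>
      (hw e).le_marginal_mul_sub hδ (hx0 e) (hM x hx e) (hxs.1 e)
  have hstep : ∑ e, (xs e * (a * (1 - x e / v e) * U e
        - 2 * a * (marginal (w e) δ M (Real.log (x e) - 2 * a)
          - marginal (w e) δ M (Real.log (x e) + a))))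
      ≤ lyapunov w δ M xs (x + a • (v - x)) - lyapunov w δ M xs x := by
    simp only [lyapunov, ← Finset.sum_sub_distrib]
    refine Finset.sum_le_sum fun e _ => ?_
    rw [← mul_sub]
    refine mul_le_mul_of_nonneg_left ?_ (hxs.1 e)
    have hr : 0 < v e / x e := div_pos (hv0 e) (hx0 e)
    have hpos : 0 < 1 + a * (v e / x e - 1) := by nlinarith
    have h := (hw e).potential_step (δ := δ) (M := M) ha ha' hr (Real.log (xs e)) (Real.log (x e))
    rw [one_div_div, ← Real.log_mul (hx0 e).ne' hpos.ne'] at h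
    have harg : x e * (1 + a * (v e / x e - 1)) = (x + a • (v - x)) e := by
      have := (hx0 e).ne'
      simp only [Pi.add_apply, Pi.smul_apply, Pi.sub_apply, smul_eq_mul]
      field_simp
    rwa [harg] at h
  have hsplit : ∑ e, (xs e * (a * (1 - x e / v e) * U e
        - 2 * a * (marginal (w e) δ M (Real.log (x e) - 2 * a)
          - marginal (w e) δ M (Real.log (x e) + a))))
      = a * (∑ e, U e * xs e - ∑ e, xs e * U e * (x e / v e)
        - 2 * ∑ e, xs e * (marginal (w e) δ M (Real.log (x e) - 2 * a)
          - marginal (w e) δ M (Real.log (x e) + a))) := by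
    rw [Finset.mul_sum, ← Finset.sum_sub_distrib, ← Finset.sum_sub_distrib, Finset.mul_sum]
    exact Finset.sum_congr rfl fun e _ => by ring
  rw [hsplit] at hstep
  have := mul_le_mul_of_nonneg_left (hgap.trans (sub_le_sub_left hfo' _)) ha.le
  linarith

/-! ### The system problem and its unique solution -/

theorem continuousOn_totalUtility (hw : ∀ e, IsUtility (w e)) :
    ContinuousOn (totalUtility w) (feasible A c) :=
  continuousOn_finsetSum _ fun e _ =>
    (hw e).continuousOn.comp (continuous_apply e).continuousOn fun _ hx => hx.1 e

theorem strictConcaveOn_totalUtility (hw : ∀ e, IsUtility (w e)) :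
    StrictConcaveOn ℝ (feasible A c) (totalUtility w) := by
  refine ⟨convex_feasible, fun x hx y hy hxy a b ha hb hab => ?_⟩
  obtain ⟨i, hi⟩ := Function.ne_iff.1 hxy
  simp only [totalUtility, smul_eq_mul, Finset.mul_sum, ← Finset.sum_add_distrib]
  refine Finset.sum_lt_sum (fun e _ => ?_) ⟨i, Finset.mem_univ i, ?_⟩
  · exact (hw e).strictConcaveOn.concaveOn.2 (hx.1 e) (hy.1 e) ha.le hb.le hab
  · exact (hw i).strictConcaveOn.2 (hx.1 i) (hy.1 i) hi ha hb hab

theorem exists_systemSolutions_eq_singleton (hw : ∀ e, IsUtility (w e))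
    (hcomp : IsCompact (feasible A c)) (hne : (feasible A c).Nonempty) :
    ∃ xs, systemSolutions A c w = {xs} := by
  obtain ⟨xs, hxs, hmax⟩ := hcomp.exists_isMaxOn hne (continuousOn_totalUtility hw)
  refine ⟨xs, eq_singleton_iff_unique_mem.2 ⟨⟨hxs, hmax⟩, fun y hy => ?_⟩⟩
  exact (strictConcaveOn_totalUtility hw).eq_of_isMaxOn hy.2 hmax hy.1 hxs

/-- Nearly optimal feasible points are close to the unique optimal solution. -/
theorem exists_gap (hw : ∀ e, IsUtility (w e)) (hcomp : IsCompact (feasible A c))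
    (hxs : systemSolutions A c w = {xs}) {N : Set (Fin n → ℝ)} (hN : N ∈ 𝓝 xs) :
    ∃ η > 0, ∀ x ∈ feasible A c, totalUtility w xs - totalUtility w x < η → x ∈ N := by
  have hmem : xs ∈ systemSolutions A c w := hxs ▸ mem_singleton xs
  obtain ⟨V, hVN, hV, hxV⟩ := mem_nhds_iff.1 hN
  rcases (feasible A c \ V).eq_empty_or_nonempty with he | hne
  · exact ⟨1, one_pos, fun x hx _ => hVN (sdiff_eq_empty.1 he hx)⟩
  obtain ⟨z, hz, hzmax⟩ := (hcomp.diff hV).exists_isMaxOn hne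
    ((continuousOn_totalUtility hw).mono sdiff_subset)
  refine ⟨totalUtility w xs - totalUtility w z, sub_pos.2 ?_, fun x hx hlt => ?_⟩
  · refine lt_of_le_of_ne (hmem.2 hz.1) fun heq => hz.2 ?_
    have : z ∈ systemSolutions A c w := ⟨hz.1, fun y hy => (hmem.2 hy).trans heq.ge⟩
    rw [hxs, mem_singleton_iff] at this
    rwa [this]
  · by_contra hxN
    have : totalUtility w x ≤ totalUtility w z := hzmax ⟨hx, fun h => hxN (hVN h)⟩
    linarith

/-- The gradient of the total utility at a maximizer `xs`, except that in the coordinates with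
`xs e = 0`, where `w e` need not be differentiable, the slope is replaced by the smaller number
`deriv (w e) M`. The bound `M` is meant to dominate all feasible coordinates. -/
noncomputable def effectiveSlope (w : Fin n → ℝ → ℝ) (M : ℝ) (xs : Fin n → ℝ) (e : Fin n) : ℝ :=
  if xs e = 0 then deriv (w e) M else deriv (w e) (xs e)

theorem effectiveSlope_pos (hw : ∀ e, IsUtility (w e)) (hM0 : 0 < M) (hxs : ∀ e, 0 ≤ xs e)
    (e : Fin n) : 0 < effectiveSlope w M xs e := by
  unfold effectiveSlope
  split_ifs with h
  · exact (hw e).deriv_pos hM0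
  · exact (hw e).deriv_pos ((hxs e).lt_of_ne' h)

/-- First-order optimality in the system problem. -/
theorem sum_effectiveSlope_mul_sub_nonpos (hw : ∀ e, IsUtility (w e))
    (hM : ∀ x ∈ feasible A c, ∀ e, x e ≤ M) (hxs : xs ∈ systemSolutions A c w)
    (hx : x ∈ feasible A c) : ∑ e, effectiveSlope w M xs e * (x e - xs e) ≤ 0 := by
  have hderiv : HasDerivAt (fun t : ℝ => ∑ e, if xs e = 0
      then w e 0 + effectiveSlope w M xs e * (t * x e) else w e (xs e + t * (x e - xs e)))
      (∑ e, effectiveSlope w M xs e * (x e - xs e)) 0 := by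
    refine HasDerivAt.fun_sum fun e _ => ?_
    by_cases h : xs e = 0
    · simp only [h, if_true, sub_zero]
      simpa using (((hasDerivAt_id (0 : ℝ)).mul_const (x e)).const_mul
        (effectiveSlope w M xs e)).const_add (w e 0)
    · simp only [h, if_false, effectiveSlope]
      have h1 : HasDerivAt (fun t : ℝ => xs e + t * (x e - xs e)) (x e - xs e) 0 := by
        simpa using ((hasDerivAt_id (0 : ℝ)).mul_const (x e - xs e)).const_add (xs e)
      have h2 : HasDerivAt (w e) (deriv (w e) (xs e)) (xs e + 0 * (x e - xs e)) := by
        simpa using ((hw e).differentiableAt _ ((hxs.1.1 e).lt_of_ne' h)).hasDerivAt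
      exact h2.comp 0 h1
  refine deriv_nonpos_of_right_max hderiv fun t ht0 ht1 => ?_
  have hmem : (fun e => xs e + t * (x e - xs e)) ∈ feasible A c := by
    convert convex_feasible hxs.1 hx (sub_nonneg.2 ht1.le) ht0.le (by ring) using 1
    ext e
    simp only [Pi.add_apply, Pi.smul_apply, smul_eq_mul]
    ring
  calc (∑ e, if xs e = 0 then w e 0 + effectiveSlope w M xs e * (t * x e)
      else w e (xs e + t * (x e - xs e)))
      ≤ totalUtility w (fun e => xs e + t * (x e - xs e)) := by
        refine Finset.sum_le_sum fun e _ => ?_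
        by_cases h : xs e = 0
        · simp only [h, if_true, effectiveSlope, sub_zero, zero_add]
          rcases (hx.1 e).eq_or_lt with h0 | h0
          · simp [← h0]
          · have hs : 0 < t * x e := mul_pos ht0 h0
            have hsM : t * x e ≤ M := by
              simpa [h] using hM _ hmem e
            have h1 := (hw e).le_tangent hs le_rfl
            have h2 := (hw e).deriv_le_deriv hs hsM
            nlinarith
        · simp [h]
    _ ≤ totalUtility w xs := hxs.2 hmem
    _ = _ := by
        refine Finset.sum_congr rfl fun e _ => ?_
        by_cases h : xs e = 0 <;> simp [h]

/-! ### Comparison of the Lyapunov function with explicit functions -/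

/-- The optimal solution maximizes the Lyapunov function, with a bound on the deficit that does
not depend on `δ` and that controls every coordinate. -/
theorem lyapunov_le (hw : ∀ e, IsUtility (w e)) (hM0 : 0 < M)
    (hM : ∀ x ∈ feasible A c, ∀ e, x e ≤ M)
    (hxs : xs ∈ systemSolutions A c w) (hδ : 0 < δ) (hδxs : ∀ e, 0 < xs e → δ ≤ xs e)
    (hx : x ∈ feasible A c) (hx0 : ∀ e, 0 < x e) :
    lyapunov w δ M xs x ≤ -∑ e, effectiveSlope w M xs e * (√(x e) - √(xs e)) ^ 2 := by
  have hkkt := sum_effectiveSlope_mul_sub_nonpos hw hM hxs hx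
  have hterm : lyapunov w δ M xs x ≤ ∑ e, effectiveSlope w M xs e * (x e - xs e)
      - ∑ e, effectiveSlope w M xs e * (√(x e) - √(xs e)) ^ 2 := by
    rw [← Finset.sum_sub_distrib]
    refine Finset.sum_le_sum fun e _ => ?_
    have hsl := effectiveSlope_pos hw hM0 hxs.1.1 e
    rcases (hxs.1.1 e).eq_or_lt with h | h
    · simp [← h, Real.sq_sqrt (hx0 e).le]
    · have hpot := (hw e).potential_sub_le (δ := δ) (M := M) (Real.log (xs e)) (Real.log (xs e))
        (Real.log (x e))
      rw [potential_self, sub_zero, marginal_log hδ h (hM xs hxs.1 e), max_eq_right (hδxs e h)]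
        at hpot
      have hsl' : deriv (w e) (xs e) = effectiveSlope w M xs e := by simp [effectiveSlope, h.ne']
      rw [hsl'] at hpot
      -- `log u ≤ 2 * (√u - 1)` for `u = x e / xs e`
      have hlog : xs e * (Real.log (x e) - Real.log (xs e)) ≤ 2 * √(xs e) * (√(x e) - √(xs e)) := by
        have hsx := Real.sqrt_pos.2 (hx0 e)
        have hss := Real.sqrt_pos.2 h
        have h1 := Real.log_le_sub_one_of_pos (div_pos hsx hss)
        rw [Real.log_div hsx.ne' hss.ne', Real.log_sqrt (hx0 e).le, Real.log_sqrt h.le] at h1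
        have h2 := mul_le_mul_of_nonneg_left h1 h.le
        have h3 : xs e * (√(x e) / √(xs e) - 1) = √(xs e) * (√(x e) - √(xs e)) := by
          nth_rw 1 [← Real.mul_self_sqrt h.le]
          field_simp
        linarith
      calc xs e * potential (w e) δ M (Real.log (xs e)) (Real.log (x e))
          ≤ xs e * ((Real.log (x e) - Real.log (xs e)) * effectiveSlope w M xs e) :=
            mul_le_mul_of_nonneg_left hpot h.le
        _ = effectiveSlope w M xs e * (xs e * (Real.log (x e) - Real.log (xs e))) := by ring
        _ ≤ effectiveSlope w M xs e * (2 * √(xs e) * (√(x e) - √(xs e))) :=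
            mul_le_mul_of_nonneg_left hlog hsl.le
        _ = effectiveSlope w M xs e * (√(x e) ^ 2 - √(xs e) ^ 2)
            - effectiveSlope w M xs e * (√(x e) - √(xs e)) ^ 2 := by ring
        _ = _ := by rw [Real.sq_sqrt (hx0 e).le, Real.sq_sqrt h.le]
  linarith

/-- Near the optimal solution the Lyapunov function is bounded below independently of `δ`. -/
theorem le_lyapunov_of_near (hw : ∀ e, IsUtility (w e)) (hM : ∀ x ∈ feasible A c, ∀ e, x e ≤ M)
    (hxs : xs ∈ feasible A c) (hδ : 0 < δ) (hδxs : ∀ e, 0 < xs e → δ ≤ xs e / 2)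
    (hx : x ∈ feasible A c) (hnear : ∀ e, 0 < xs e → xs e / 2 < x e) :
    -∑ e, xs e * (deriv (w e) (xs e / 2) * |Real.log (x e) - Real.log (xs e)|)
      ≤ lyapunov w δ M xs x := by
  rw [← Finset.sum_neg_distrib]
  refine Finset.sum_le_sum fun e _ => ?_
  rcases (hxs.1 e).eq_or_lt with h | h
  · simp [← h]
  rw [← mul_neg]
  refine mul_le_mul_of_nonneg_left ?_ h.le
  have hxe : 0 < x e := (half_pos h).trans (hnear e h)
  have hpot := (hw e).le_potential_sub (δ := δ) (M := M) (Real.log (xs e)) (Real.log (xs e))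
    (Real.log (x e))
  rw [potential_self, sub_zero, marginal_log hδ hxe (hM x hx e),
    max_eq_right ((hδxs e h).trans (hnear e h).le)] at hpot
  have h1 := (hw e).deriv_le_deriv (half_pos h) (hnear e h).le
  have h2 := (hw e).deriv_pos hxe
  have h3 := neg_abs_le (Real.log (x e) - Real.log (xs e))
  have h4 := abs_nonneg (Real.log (x e) - Real.log (xs e))
  nlinarith

end Lyapunov

/-! ### Runs of the algorithm -/

section Run

variable {m n : ℕ} {A : Matrix (Fin m) (Fin n) ℝ} {c : Fin m → ℝ} {w : Fin n → ℝ → ℝ} {δ M : ℝ}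
  {xs : Fin n → ℝ} {x : ℕ → Fin n → ℝ}

theorem stepSize_succ_pos (k : ℕ) : 0 < stepSize (k + 1) := by
  unfold stepSize; positivity

theorem stepSize_succ_le (k : ℕ) : stepSize (k + 1) ≤ 1 / 2 := by
  unfold stepSize
  push_cast
  gcongr
  linarith [(Nat.cast_nonneg k : (0 : ℝ) ≤ k)]

theorem tendsto_stepSize_succ : Tendsto (fun k => stepSize (k + 1)) atTop (𝓝 0) :=
  (tendsto_add_atTop_iff_nat (f := stepSize) 1).2 tendsto_one_div_add_atTop_nhds_zero_nat

theorem not_summable_stepSize_succ : ¬ Summable fun k => stepSize (k + 1) := by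
  have h : (fun k => stepSize (k + 1)) = fun k : ℕ => 1 / ((k + 2 : ℕ) : ℝ) := by
    ext k
    simp only [stepSize]
    push_cast
    ring
  rw [h]
  exact fun hs => Real.not_summable_one_div_natCast ((summable_nat_add_iff 2).1 hs)

theorem update_mem_and_pos {z v : Fin n → ℝ} {a : ℝ} (ha : 0 < a) (ha' : a ≤ 1 / 2)
    (hz : z ∈ feasible A c) (hz0 : ∀ e, 0 < z e) (hv : v ∈ feasible A c) :
    z + a • (v - z) ∈ feasible A c ∧ ∀ e, 0 < (z + a • (v - z)) e := by
  have h : z + a • (v - z) = (1 - a) • z + a • v := by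
    rw [smul_sub, sub_smul, one_smul]; abel
  rw [h]
  refine ⟨convex_feasible hz hv (by linarith) ha.le (by ring), fun e => ?_⟩
  exact add_pos_of_pos_of_nonneg (mul_pos (by linarith) (hz0 e)) (mul_nonneg ha.le (hv.1 e))

theorem IsRun.mem_and_pos (hx : IsRun A c w x) (k : ℕ) :
    x k ∈ feasible A c ∧ ∀ e, 0 < x k e := by
  induction k with
  | zero => exact ⟨hx.start_feasible, hx.start_pos⟩
  | succ k ih =>
    obtain ⟨v, hv, hstep⟩ := hx.step k
    rw [hstep]
    exact update_mem_and_pos (stepSize_succ_pos k) (stepSize_succ_le k) ih.1 ih.2 hv.1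

/-- The iterates stay positive, so prices are positive and every step is possible. -/
theorem exists_isRun (hw : ∀ e, IsUtility (w e)) (hcomp : IsCompact (feasible A c))
    {x₀ : Fin n → ℝ} (hx₀ : x₀ ∈ feasible A c) (hpos : ∀ e, 0 < x₀ e) :
    ∃ x, IsRun A c w x ∧ x 0 = x₀ := by
  have hex : ∀ (k : ℕ) (z : {z // z ∈ feasible A c ∧ ∀ e, 0 < z e}),
      ∃ z' : {z // z ∈ feasible A c ∧ ∀ e, 0 < z e}, ∃ v ∈ T A c w z,
        (z' : Fin n → ℝ) = z + stepSize (k + 1) • (v - z) := fun k z => by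
    obtain ⟨v, hv⟩ := networkSolutions_nonempty hcomp (price_pos hw z.2.2) ⟨z, z.2⟩
    exact ⟨⟨_, update_mem_and_pos (stepSize_succ_pos k) (stepSize_succ_le k) z.2.1 z.2.2 hv.1⟩,
      v, hv, rfl⟩
  choose F hF using hex
  obtain ⟨x, hx0, hstep⟩ : ∃ x : ℕ → {z // z ∈ feasible A c ∧ ∀ e, 0 < z e},
      x 0 = ⟨x₀, hx₀, hpos⟩ ∧ ∀ k, x (k + 1) = F k (x k) :=
    ⟨fun k => Nat.rec ⟨x₀, hx₀, hpos⟩ F k, rfl, fun _ => rfl⟩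
  refine ⟨fun k => x k, ⟨(x 0).2.1, (x 0).2.2, fun k => ?_⟩, by simp [hx0]⟩
  simp only [hstep]
  exact hF k (x k)

/-- The truncation parameter `δ` has to be chosen after the gap `η` for which nearly optimal
points have almost maximal Lyapunov value; this is possible because both comparisons of the
Lyapunov function with explicit functions, `lyapunov_le` and `le_lyapunov_of_near`, are uniform in
`δ`. -/
theorem IsRun.eventually_sum_effectiveSlope_lt (hx : IsRun A c w x) (hw : ∀ e, IsUtility (w e))
    (hA : ∀ l e, A l e = 0 ∨ A l e = 1) (hcomp : IsCompact (feasible A c))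
    (hM0 : 0 < M) (hM : ∀ x ∈ feasible A c, ∀ e, x e ≤ M)
    (hxs : systemSolutions A c w = {xs}) {β : ℝ} (hβ : 0 < β) :
    ∀ᶠ k in atTop, ∑ e, effectiveSlope w M xs e * (√(x k e) - √(xs e)) ^ 2 < β := by
  have hmem : xs ∈ systemSolutions A c w := hxs ▸ mem_singleton xs
  have hxA := fun k => (hx.mem_and_pos k).1
  have hx0 := fun k => (hx.mem_and_pos k).2
  -- a neighbourhood of `xs` on which every Lyapunov function with small `δ` exceeds `-(β / 2)`
  have hN : ∀ᶠ z in 𝓝 xs, (∀ e, 0 < xs e → xs e / 2 < z e) ∧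
      ∑ e, xs e * (deriv (w e) (xs e / 2) * |Real.log (z e) - Real.log (xs e)|) < β / 2 := by
    refine (eventually_all.2 fun e => ?_).and ?_
    · by_cases h : 0 < xs e
      · filter_upwards [(continuous_apply e).continuousAt.eventually_const_lt (half_lt_self h)]
          with z hz _ using hz
      · exact Eventually.of_forall fun z h' => absurd h' h
    · have hc : ContinuousAt (fun z : Fin n → ℝ => ∑ e, xs e *
          (deriv (w e) (xs e / 2) * |Real.log (z e) - Real.log (xs e)|)) xs := by
        refine tendsto_finsetSum _ fun e _ => ?_
        rcases (hmem.1.1 e).eq_or_lt with h | h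
        · simp only [← h, zero_mul]
          exact tendsto_const_nhds
        · have h1 : ContinuousAt (fun z : Fin n → ℝ => z e) xs := (continuous_apply e).continuousAt
          exact (((h1.log h.ne').sub continuousAt_const).abs.const_mul _).const_mul _
      exact hc.eventually_lt_const (by simpa using half_pos hβ)
  obtain ⟨η, hη, hgap⟩ := exists_gap hw hcomp hxs hN
  obtain ⟨δ, hδ, hδM, hδxs, hδη⟩ : ∃ δ > 0, δ ≤ M ∧ (∀ e, 0 < xs e → δ ≤ xs e / 2) ∧
      ∑ e, (w e δ - w e 0) < η / 4 := by
    have h1 : ∀ᶠ δ in 𝓝[>] (0 : ℝ), ∑ e, (w e δ - w e 0) < η / 4 := by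
      have : Tendsto (fun δ => ∑ e, (w e δ - w e 0)) (𝓝[>] (0 : ℝ)) (𝓝 (∑ e, (w e 0 - w e 0))) :=
        tendsto_finsetSum _ fun e _ => Tendsto.sub_const
          (((hw e).continuousOn 0 self_mem_Ici).mono_left (nhdsWithin_mono _ Ioi_subset_Ici_self)) _
      exact this.eventually_lt_const (by simpa using hη)
    have h2 : ∀ᶠ δ in 𝓝[>] (0 : ℝ), ∀ e, 0 < xs e → δ ≤ xs e / 2 := eventually_all.2 fun e => by
      by_cases h : 0 < xs e
      · filter_upwards [Ioo_mem_nhdsGT (half_pos h)] with δ hδ _ using hδ.2.le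
      · exact Eventually.of_forall fun z h' => absurd h' h
    obtain ⟨δ, hδ, h1, h2⟩ :=
      (Filter.Eventually.and (Ioo_mem_nhdsGT hM0) (h1.and h2)).exists
    exact ⟨δ, hδ.1, hδ.2.le, h2, h1⟩
  have hle : ∀ k, lyapunov w δ M xs (x k) ≤
      -∑ e, effectiveSlope w M xs e * (√(x k e) - √(xs e)) ^ 2 := fun k =>
    lyapunov_le hw hM0 hM hmem hδ (fun e he => (hδxs e he).trans (half_le_self he.le)) (hxA k)
      (hx0 k)
  have hosc : ∀ᶠ k in atTop, ∀ e t, marginal (w e) δ M (t - 2 * stepSize (k + 1))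
      - marginal (w e) δ M (t + stepSize (k + 1)) < η / (8 * (1 + ∑ e, xs e)) := by
    refine eventually_all.2 fun e => tendsto_stepSize_succ.eventually
      ((hw e).eventually_marginal_sub_lt hδ hδM (div_pos hη ?_))
    have := Finset.sum_nonneg fun e (_ : e ∈ Finset.univ) => hmem.1.1 e
    positivity
  have hev := eventually_gt_of_step (f := fun k => lyapunov w δ M xs (x k))
    (g := fun k => totalUtility w xs - totalUtility w (x k)) (C := 0) hη hβ
    (fun k => (hle k).trans (neg_nonpos.2 (Finset.sum_nonneg fun e _ =>
      mul_nonneg (effectiveSlope_pos hw hM0 hmem.1.1 e).le (sq_nonneg _))))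
    (fun k => (stepSize_succ_pos k).le) tendsto_stepSize_succ not_summable_stepSize_succ
    (fun k => sub_nonneg.2 (hmem.2 (hxA k))) ?_ fun k hk => ?_
  · filter_upwards [hev] with k hk
    have := hle k
    linarith
  · filter_upwards [hosc] with k hk
    obtain ⟨v, hv, hstep⟩ := hx.step k
    have h := lyapunov_step (δ := δ) hw hA hM hδ hmem.1 (hxA k) (hx0 k) hv (stepSize_succ_pos k)
      (stepSize_succ_le k)
    rw [← hstep] at h
    refine le_trans ?_ h
    gcongr _ + _ * ?_
    · exact (stepSize_succ_pos k).le
    have hS : 0 ≤ ∑ e, xs e := Finset.sum_nonneg fun e _ => hmem.1.1 e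
    have h1 : ∑ e, xs e * (marginal (w e) δ M (Real.log (x k e) - 2 * stepSize (k + 1))
          - marginal (w e) δ M (Real.log (x k e) + stepSize (k + 1)))
        ≤ ∑ e, xs e * (η / (8 * (1 + ∑ e, xs e))) :=
      Finset.sum_le_sum fun e _ => mul_le_mul_of_nonneg_left (hk e _).le (hmem.1.1 e)
    have h2 : ∑ e, xs e * (η / (8 * (1 + ∑ e, xs e))) ≤ η / 8 := by
      rw [← Finset.sum_mul, ← mul_div_assoc, div_le_div_iff₀ (by positivity) (by norm_num)]
      nlinarith
    linarith
  · obtain ⟨h1, h2⟩ := hgap (x k) (hxA k) hk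
    have := le_lyapunov_of_near hw hM hmem.1 hδ hδxs (hxA k) h1
    linarith

theorem IsRun.tendsto (hx : IsRun A c w x) (hw : ∀ e, IsUtility (w e))
    (hA : ∀ l e, A l e = 0 ∨ A l e = 1) (hpath : ∀ e, ∃ l, A l e = 1)
    (hxs : systemSolutions A c w = {xs}) : Tendsto x atTop (𝓝 xs) := by
  obtain ⟨M, hM0, hM⟩ := exists_bound (c := c) hA hpath
  have hmem : xs ∈ systemSolutions A c w := hxs ▸ mem_singleton xs
  refine tendsto_pi_nhds.2 fun e => ?_
  have hsl := effectiveSlope_pos hw hM0 hmem.1.1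
  have hsq : Tendsto (fun k => (√(x k e) - √(xs e)) ^ 2) atTop (𝓝 0) := by
    refine tendsto_order.2 ⟨fun b hb => Eventually.of_forall fun k => hb.trans_le (sq_nonneg _),
      fun b hb => ?_⟩
    filter_upwards [hx.eventually_sum_effectiveSlope_lt hw hA (isCompact_feasible hA hpath) hM0 hM
      hxs (mul_pos (hsl e) hb)] with k hk
    refine lt_of_mul_lt_mul_left (lt_of_le_of_lt ?_ hk) (hsl e).le
    exact Finset.single_le_sum (f := fun e => effectiveSlope w M xs e * (√(x k e) - √(xs e)) ^ 2)
      (fun i _ => mul_nonneg (hsl i).le (sq_nonneg _)) (Finset.mem_univ e)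
  have hsub : Tendsto (fun k => √(x k e) - √(xs e)) atTop (𝓝 0) := by
    have := hsq.sqrt
    simp only [Real.sqrt_sq_eq_abs, Real.sqrt_zero] at this
    exact (tendsto_zero_iff_abs_tendsto_zero _).2 this
  have hsqrt : Tendsto (fun k => √(x k e)) atTop (𝓝 √(xs e)) := tendsto_sub_nhds_zero_iff.1 hsub
  have := hsqrt.pow 2
  rw [Real.sq_sqrt (hmem.1.1 e)] at this
  exact this.congr fun k => Real.sq_sqrt ((hx.mem_and_pos k).2 e).le

end Run

end NUM

theorem theorem1 {m n : ℕ} (A : Matrix (Fin m) (Fin n) ℝ) (c : Fin m → ℝ) (w : Fin n → ℝ → ℝ)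
    (hA : ∀ l e, A l e = 0 ∨ A l e = 1)
    (hpath : ∀ e, ∃ l, A l e = 1)
    (hint : ∃ x : Fin n → ℝ, (∀ e, 0 < x e) ∧ ∀ l, (A *ᵥ x) l < c l)
    (hconc : ∀ e, StrictConcaveOn ℝ (Set.Ici 0) (w e))
    (hmono : ∀ e, MonotoneOn (w e) (Set.Ici 0))
    (hcont : ∀ e, ContinuousOn (w e) (Set.Ici 0))
    (hdiff : ∀ e, ∀ t : ℝ, 0 < t → DifferentiableAt ℝ (w e) t) :
    ∃ xstar : Fin n → ℝ,
      NUM.systemSolutions A c w = {xstar} ∧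
      (∀ x₀ ∈ NUM.feasible A c, (∀ e, 0 < x₀ e) →
        ∃ x : ℕ → Fin n → ℝ, NUM.IsRun A c w x ∧ x 0 = x₀) ∧
      ∀ x : ℕ → Fin n → ℝ, NUM.IsRun A c w x →
        (∀ k, x k ∈ NUM.feasible A c) ∧
        Filter.Tendsto x Filter.atTop (nhds xstar) := by
  have hw : ∀ e, NUM.IsUtility (w e) := fun e => ⟨hconc e, hmono e, hcont e, hdiff e⟩
  have hcomp := NUM.isCompact_feasible (c := c) hA hpath
  obtain ⟨z, hz0, hz⟩ := hint
  obtain ⟨xs, hxs⟩ := NUM.exists_systemSolutions_eq_singleton hw hcomp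
    ⟨z, fun e => (hz0 e).le, fun l => (hz l).le⟩
  exact ⟨xs, hxs, fun x₀ hx₀ hpos => NUM.exists_isRun hw hcomp hx₀ hpos,
    fun x hx => ⟨fun k => (hx.mem_and_pos k).1, hx.tendsto hw hA hpath hxs⟩⟩
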